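/- Let $G=(V,E)$ be a finite directed acyclic graph (parallel edges allowed) with sources $s_1,\dots,s_m\in V$, a finite set of sinks $T\subseteq V$, and for each sink $t\in T$ a demand set $\mathrm{dem}(t)\subseteq\{1,\dots,m\}$. Fix a rate $(r_1,\dots,r_m)\in\mathbb{N}^m$ and put $r=r_1+\dots+r_m$. Add new vertices $s_1^*,\dots,s_m^*$ and, for each $i$, $r_i$ parallel edges from $s_i^*$ to $s_i$; let $S^*=\{s_1^*,\dots,s_m^*\}$. For a finite field $\mathbb{F}$, let $\{b_{i,j}: 1\le i\le m,\ 1\le j\le r_i\}$ be the standard basis of $\mathbb{F}^r$. Given coefficients $c_{a,e}\in\mathbb{F}$, one for each pair consisting of an edge $e\in E$ and an edge $a$ of the enlarged graph whose head is the tail of $e$, define recursively $\psi(e)=b_{i,j}$ if $e$ is the $j$-th edge from $s_i^*$ to $s_i$, and $\psi(e)=\sum_{a:\,\mathrm{head}(a)=\mathrm{tail}(e)}c_{a,e}\,\psi(a)$ if $e\in E$. The code achieves the rate $(r_1,\dots,r_m)$ if for every $t\in T$ all $b_{i,j}$ with $i\in\mathrm{dem}(t)$, $1\le j\le r_i$,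 lie in $\mathrm{span}\{\psi(e):\mathrm{head}(e)=t\}$, where $e$ ranges over all edges of the enlarged graph. Random linear network coding chooses the coefficients $c_{a,e}$ independently and uniformly from $\mathbb{F}$. For a set $A$ of vertices of the enlarged graph, let $\mathrm{maxflow}(A,t)$ be the maximum number of pairwise edge-disjoint directed paths in the enlarged graph, each from some vertex of $A$ to $t$. **Theorem.** Random linear network coding achieves the rate $(r_1,\dots,r_m)$ with probability tending to $1$ as $|\mathbb{F}|\to\infty$ if and only if, for every sink $t\in T$, $$\mathrm{maxflow}\bigl(S^*\setminus\{s_i^*: i\in\mathrm{dem}(t)\},\,t\bigr)+\sum_{i\in\mathrm{dem}(t)}r_i=\mathrm{maxflow}(S^*,t).$$ Moreover, if this condition fails, then random linear network coding achieves the rate $(r_1,\dots,r_m)$ with probability tending to $0$ as $|\mathbb{F}|\to\infty$. -/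

import Mathlib

namespace RLNC

/-- A directed multigraph on the vertex type `V` with edge type `E`: the edge `e` goes from
`tail e` to `head e`; parallel edges are allowed. -/
structure MultiDigraph (V E : Type*) where
  tail : E → V
  head : E → V

namespace MultiDigraph

variable {V E : Type*} (G : MultiDigraph V E)

/-- There is an edge from `u` to `v`. -/
def Adj (u v : V) : Prop := ∃ e, G.tail e = u ∧ G.head e = v

/-- No closed directed walk of positive length. -/
def Acyclic : Prop := ∀ v, ¬ Relation.TransGen G.Adj v v

/-- The edge `a` ends where the edge `b` starts. -/
def Precedes (a b : E) : Prop := G.head a = G.tail b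

/-- `l` is the edge sequence of a (nonempty) directed path from a vertex of `A` to `t`. In an
acyclic graph, the only kind used here, vertices on such a sequence are automatically distinct. -/
def IsPath (A : Set V) (t : V) (l : List E) : Prop :=
  l.IsChain G.Precedes ∧
    (∃ e ∈ l.head?, G.tail e ∈ A) ∧ (∃ e ∈ l.getLast?, G.head e = t)

/-- The maximum number of pairwise edge-disjoint directed paths, each from some vertex of `A`
to `t` (the supremum is over a set of numbers containing `0` and bounded by the number of edges). -/
noncomputable def maxflow (A : Set V) (t : V) : ℕ :=
  sSup {k : ℕ | ∃ p : Fin k → List E,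
    (∀ i, G.IsPath A t (p i)) ∧ ∀ i j, i ≠ j → List.Disjoint (p i) (p j)}

theorem Acyclic.wellFounded [Finite E] {G : MultiDigraph V E} (hG : G.Acyclic) :
    WellFounded G.Precedes := by
  have hirr : ∀ a, ¬ Relation.TransGen G.Precedes a a := by
    intro a h
    exact hG (G.tail a) (Relation.TransGen.lift G.tail (fun x y hxy => ⟨x, rfl, hxy⟩) _ _ h)
  have : Std.Irrefl (Relation.TransGen G.Precedes) := ⟨hirr⟩
  have hwf : WellFounded (Relation.TransGen G.Precedes) :=
    Finite.wellFounded_of_trans_of_irrefl _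
  exact Subrelation.wf (fun h => Relation.TransGen.single h) hwf

end MultiDigraph

/-- An acyclic multi-source multi-sink network: an acyclic directed multigraph, sources
`s_1, …, s_m`, a finite set of sinks, and for each sink `t` the set `dem t` of indices of the
sources it demands (`dem` is only used at sinks). -/
structure Network (V E : Type*) (m : ℕ) extends MultiDigraph V E where
  acyclic : toMultiDigraph.Acyclic
  source : Fin m → V
  sinks : Finset V
  dem : V → Finset (Fin m)

namespace Network

variable {V E : Type*} {m : ℕ} (N : Network V E m) (r : Fin m → ℕ)

/-- The network with the auxiliary super-sources: vertices `V` (as `Sum.inl v`) and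
`s_i^* = Sum.inr i`; edges `E` together with `r i` edges from `s_i^*` to `s_i`. -/
def extend : MultiDigraph (V ⊕ Fin m) (E ⊕ (Σ i : Fin m, Fin (r i))) where
  tail := Sum.elim (fun e => Sum.inl (N.tail e)) (fun ij => Sum.inr ij.1)
  head := Sum.elim (fun e => Sum.inl (N.head e)) (fun ij => Sum.inl (N.source ij.1))

theorem extend_acyclic : (N.extend r).Acyclic := by
  have key : ∀ x y, Relation.TransGen (N.extend r).Adj x y → ∀ u, x = Sum.inl u →
      ∃ v, y = Sum.inl v ∧ Relation.TransGen N.Adj u v := by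
    intro x y h u hu
    subst hu
    induction h with
    | single h =>
      obtain ⟨e | ij, h1, h2⟩ := h
      · simp only [extend, Sum.elim_inl, Sum.inl.injEq] at h1 h2
        exact ⟨_, h2.symm, .single ⟨e, h1, rfl⟩⟩
      · simp [extend] at h1
    | tail _ h ih =>
      obtain ⟨v, rfl, hv⟩ := ih
      obtain ⟨e | ij, h1, h2⟩ := h
      · simp only [extend, Sum.elim_inl, Sum.inl.injEq] at h1 h2
        exact ⟨_, h2.symm, hv.tail ⟨e, h1, rfl⟩⟩
      · simp [extend] at h1
  rintro (v | i) h
  · obtain ⟨w, hw, h'⟩ := key _ _ h v rfl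
    cases hw
    exact N.acyclic v h'
  · obtain ⟨b, -, e | ij, -, h2⟩ := Relation.TransGen.tail'_iff.mp h <;> simp [extend] at h2

/-- Set `S^*` of super-sources. -/
def superSources : Set (V ⊕ Fin m) := Set.range Sum.inr

/-- Index set of the local coding coefficients: pairs `(a, e)` where `e` is an original edge and
`a` is an edge (possibly from a super-source) that ends at the tail of `e`. -/
def CoeffIndex : Type _ :=
  {p : (E ⊕ (Σ i : Fin m, Fin (r i))) × E // (N.extend r).Precedes p.1 (Sum.inl p.2)}

instance [Finite E] : Finite (N.CoeffIndex r) := by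
  unfold CoeffIndex
  infer_instance

section Coding

variable [Fintype E] {F : Type*} [Field F]

open scoped Classical in
/-- The linear network code `ψ` with coefficients `c`. The space `F^r`, `r = r_1 + ⋯ + r_m`, has
coordinates indexed by the pairs `(i, j)` with `j < r i`. The `j`-th edge from `s_i^*` to `s_i`
carries the standard basis vector `b_{i,j}`; any other edge `e` carries the linear combination,
with coefficients `c (a, e)`, of the vectors on the edges `a` that end at the tail of `e`. -/
noncomputable def code (c : N.CoeffIndex r → F) :
    (E ⊕ (Σ i : Fin m, Fin (r i))) → ((Σ i : Fin m, Fin (r i)) → F) :=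
  (N.extend_acyclic r).wellFounded.fix fun x rec =>
    match x, rec with
    | Sum.inr ij, _ => Pi.single ij 1
    | Sum.inl e, rec =>
      ∑ a : {a // (N.extend r).Precedes a (Sum.inl e)}, c ⟨(a.1, e), a.2⟩ • rec a.1 a.2

theorem code_inr (c : N.CoeffIndex r → F) (ij : Σ i : Fin m, Fin (r i)) :
    N.code r c (Sum.inr ij) = Pi.single ij 1 := by
  rw [code, WellFounded.fix_eq]

open scoped Classical in
theorem code_inl (c : N.CoeffIndex r → F) (e : E) :
    N.code r c (Sum.inl e) =
      ∑ a : {a // (N.extend r).Precedes a (Sum.inl e)},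
        c ⟨(a.1, e), a.2⟩ • N.code r c a.1 := by
  rw [code, WellFounded.fix_eq]

/-- The sink `t` can decode all symbols it demands: each `b_{i,j}` with `i ∈ dem t` lies in the
span of the vectors carried by the edges entering `t`. -/
def Decodes (c : N.CoeffIndex r → F) (t : V) : Prop :=
  ∀ i ∈ N.dem t, ∀ j : Fin (r i),
    (Pi.single ⟨i, j⟩ 1 : (Σ i : Fin m, Fin (r i)) → F) ∈
      Submodule.span F {v | ∃ a, (N.extend r).head a = Sum.inl t ∧ v = N.code r c a}

/-- The code with coefficients `c` achieves rate `r`: every sink decodes its demand. -/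
def Succeeds (c : N.CoeffIndex r → F) : Prop := ∀ t ∈ N.sinks, N.Decodes r c t

end Coding

open scoped Classical in
/-- Probability that random linear network coding over the finite field `F` achieves rate `r`:
the coefficient family is uniform on `F`-valued families, i.e. the coefficients are
independent and uniform on `F`. -/
noncomputable def successProb [Fintype E] (F : Type) [Field F] [Fintype F] : ℝ :=
  letI : Fintype (N.CoeffIndex r) := Fintype.ofFinite _
  ((PMF.uniformOfFintype (N.CoeffIndex r → F)).toOuterMeasure {c | N.Succeeds r c}).toReal

end Network

/-- `P F → l` as the finite field `F` varies with `|F| → ∞`. -/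
def TendstoLargeField (P : ∀ (F : Type) [Field F] [Fintype F], ℝ) (l : ℝ) : Prop :=
  ∀ ε > 0, ∃ n : ℕ, ∀ (F : Type) [Field F] [Fintype F], n ≤ Fintype.card F → |P F - l| < ε

end RLNC

/-! For a set `B` of sources, let the rank from `B` be the dimension of what `t` receives once the
coordinates outside `B` are deleted. Decoding is a rank identity: `t` recovers its demand iff
deleting the demanded coordinates lowers the received dimension by exactly their number
(`decodes_iff_rankFrom`).

Every choice of coefficients keeps the rank from `B` at most the flow from `B`, because independent
vectors can be traced back along edge-disjoint paths by an exchange argument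
(`rankFrom_le_maxflow`). Equality is generic: routing along a maximum family of disjoint paths makes
a certain minor equal to 1, so this minor is a nonzero polynomial in the coefficients, of degree
bounded independently of the field, and Schwartz–Zippel applies (`exists_coeffProb_rankFrom_ne_le`).

Hence, outside an event of probability `O(1/|F|)`, decoding at `t` is equivalent to the flow
condition at `t`. A union bound over sinks gives limit 1; a single violating sink gives limit 0. -/

namespace RLNC

/-! ### Independent vectors and edge-disjoint paths -/

namespace MultiDigraph

variable {V X : Type*} {G : MultiDigraph V X}

/-- The edges of a finite acyclic multigraph admit an injective topological numbering. -/
theorem Acyclic.exists_numbering [Finite X] (hG : G.Acyclic) :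
    ∃ f : X → ℕ, Function.Injective f ∧ ∀ a b, G.Precedes a b → f a < f b := by
  classical
  have : Fintype X := Fintype.ofFinite X
  have hwf : WellFounded (Relation.TransGen G.Precedes) := hG.wellFounded.transGen
  have hpo : IsPartialOrder X (Relation.ReflTransGen G.Precedes) :=
    { refl := fun _ => .refl
      trans := fun _ _ _ => .trans
      antisymm := fun a b hab hba => by
        rcases Relation.reflTransGen_iff_eq_or_transGen.mp hab with h | h
        · exact h.symm
        · exact absurd (h.trans_left hba) (hwf.irrefl.irrefl a) }
  -- Extend reachability to a linear order; each edge is numbered by the size of its lower set.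
  obtain ⟨s, hs, hle⟩ := extend_partialOrder (Relation.ReflTransGen G.Precedes)
  have hmono : ∀ a b, s a b → a ≠ b →
      (Finset.univ.filter fun y => s y a).card < (Finset.univ.filter fun y => s y b).card := by
    intro a b hab hne
    apply Finset.card_lt_card
    rw [Finset.ssubset_iff_of_subset]
    · refine ⟨b, by simp [hs.refl b], ?_⟩
      intro h
      exact hne (hs.antisymm _ _ hab (by simpa using h))
    · intro y hy
      simp only [Finset.mem_filter, Finset.mem_univ, true_and] at hy ⊢
      exact hs.trans _ _ _ hy hab
  refine ⟨fun x => (Finset.univ.filter fun y => s y x).card, ?_, ?_⟩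
  · intro a b hab
    by_contra hne
    rcases hs.total a b with h | h
    · exact (hmono a b h hne).ne hab
    · exact (hmono b a h (Ne.symm hne)).ne hab.symm
  · intro a b hab
    refine hmono a b (hle _ _ (.single hab)) ?_
    rintro rfl
    exact hwf.irrefl.irrefl a (.single hab)

/-- If every vector outside the starting edges `S₀` is a linear combination of the vectors on the
preceding edges, then edges carrying independent vectors end edge-disjoint paths that begin
in `S₀`. -/
theorem exists_disjoint_paths_of_linearIndepOn {K M : Type*} [Field K] [AddCommGroup M]
    [Module K M] (f : X → ℕ) (hinj : Function.Injective f)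
    (hf : ∀ a b, G.Precedes a b → f a < f b) (φ : X → M) (S₀ : Set X)
    (hφ : ∀ x ∉ S₀, φ x ∈ Submodule.span K (φ '' {a | G.Precedes a x})) (n : ℕ) :
    ∀ S : Set X, (∀ x ∈ S, f x < n) → LinearIndepOn K φ S →
      ∃ p : X → List X,
        (∀ x ∈ S, (p x).IsChain G.Precedes ∧ (∃ e ∈ (p x).head?, e ∈ S₀) ∧
          (p x).getLast? = some x ∧ ∀ y ∈ p x, f y < n) ∧
        ∀ x ∈ S, ∀ y ∈ S, x ≠ y → List.Disjoint (p x) (p y) := by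
  classical
  -- Induction on a strict bound for the numbers in `S`. At most one edge of `S` has number `n`; it
  -- is exchanged for an earlier edge unless it already lies in `S₀`.
  induction n with
  | zero =>
    intro S hS _
    exact ⟨fun _ => [], fun x hx => absurd (hS x hx) (by simp),
      fun x hx => absurd (hS x hx) (by simp)⟩
  | succ n ih =>
    intro S hS hind
    by_cases hx : ∃ x ∈ S, f x = n
    swap
    · push Not at hx
      obtain ⟨p, hp, hd⟩ := ih S (fun x h => by have := hS x h; have := hx x h; omega) hind
      exact ⟨p, fun x h => ⟨(hp x h).1, (hp x h).2.1, (hp x h).2.2.1,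
        fun y hy => ((hp x h).2.2.2 y hy).trans n.lt_succ_self⟩, hd⟩
    obtain ⟨x, hxS, hxn⟩ := hx
    have hlt : ∀ y ∈ S \ {x}, f y < n := by
      intro y hy
      have h1 := hS y hy.1
      have h2 : f y ≠ n := fun h => hy.2 (hinj (h.trans hxn.symm))
      omega
    -- It suffices to find the path to `x`, all the others avoiding edge number `n`.
    have key : ∀ (p : X → List X) (q : List X),
        (∀ y ∈ S \ {x}, (p y).IsChain G.Precedes ∧ (∃ e ∈ (p y).head?, e ∈ S₀) ∧
          (p y).getLast? = some y ∧ ∀ z ∈ p y, f z < n) →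
        (∀ y ∈ S \ {x}, ∀ z ∈ S \ {x}, y ≠ z → List.Disjoint (p y) (p z)) →
        q.IsChain G.Precedes → (∃ e ∈ q.head?, e ∈ S₀) → q.getLast? = some x →
        (∀ z ∈ q, f z < n + 1) → (∀ y ∈ S \ {x}, List.Disjoint q (p y)) →
        ∃ p : X → List X,
          (∀ x ∈ S, (p x).IsChain G.Precedes ∧ (∃ e ∈ (p x).head?, e ∈ S₀) ∧
            (p x).getLast? = some x ∧ ∀ y ∈ p x, f y < n + 1) ∧
          ∀ x ∈ S, ∀ y ∈ S, x ≠ y → List.Disjoint (p x) (p y) := by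
      intro p q hp hd h1 h2 h3 h4 h5
      refine ⟨Function.update p x q, ?_, ?_⟩
      · intro y hy
        by_cases hyx : y = x
        · subst hyx
          simpa only [Function.update_self] using ⟨h1, h2, h3, h4⟩
        · rw [Function.update_of_ne hyx]
          have := hp y ⟨hy, hyx⟩
          exact ⟨this.1, this.2.1, this.2.2.1, fun z hz => (this.2.2.2 z hz).trans n.lt_succ_self⟩
      · intro y hy z hz hyz
        by_cases hyx : y = x
        · subst hyx
          rw [Function.update_self, Function.update_of_ne hyz.symm]
          exact h5 z ⟨hz, hyz.symm⟩
        · rw [Function.update_of_ne hyx]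
          by_cases hzx : z = x
          · subst hzx
            rw [Function.update_self]
            exact (h5 y ⟨hy, hyx⟩).symm
          · rw [Function.update_of_ne hzx]
            exact hd y ⟨hy, hyx⟩ z ⟨hz, hzx⟩ hyz
    have hind' : LinearIndepOn K φ (S \ {x}) := hind.mono Set.sdiff_subset
    by_cases hx0 : x ∈ S₀
    · obtain ⟨p, hp, hd⟩ := ih (S \ {x}) hlt hind'
      refine key p [x] hp hd (by simp) (by simpa using hx0) (by simp) (by simp [hxn]) ?_
      intro y hy
      rw [List.singleton_disjoint]
      intro h
      exact absurd ((hp y hy).2.2.2 x h) (by omega)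
    -- Steinitz exchange: if all predecessors of `x` had vectors in the span of the rest of `S`, so
    -- would `x`, against independence.
    · obtain ⟨a, hax, ha⟩ : ∃ a, G.Precedes a x ∧ φ a ∉ Submodule.span K (φ '' (S \ {x})) := by
        by_contra! hcon
        have h1 : φ x ∈ Submodule.span K (φ '' (S \ {x})) := by
          refine Submodule.span_le.mpr ?_ (hφ x hx0)
          rintro _ ⟨a, ha, rfl⟩
          exact hcon a ha
        exact LinearIndepOn.notMem_span hind hxS h1
      -- So the path to `a` is not already in use, and can be prolonged by `x`.
      have haS : a ∉ S \ {x} := fun h => ha (Submodule.subset_span ⟨a, h, rfl⟩)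
      obtain ⟨p, hp, hd⟩ := ih (insert a (S \ {x}))
        (by
          rintro y (rfl | hy)
          · exact hxn ▸ hf _ _ hax
          · exact hlt y hy)
        ((linearIndepOn_insert haS).mpr ⟨hind', ha⟩)
      have hpa := hp a (Set.mem_insert _ _)
      refine key p (p a ++ [x]) (fun y hy => hp y (Set.mem_insert_of_mem _ hy))
        (fun y hy z hz => hd y (Set.mem_insert_of_mem _ hy) z (Set.mem_insert_of_mem _ hz))
        ?_ ?_ (by simp) ?_ ?_
      · rw [List.isChain_append]
        refine ⟨hpa.1, by simp, ?_⟩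
        intro u hu v hv
        rw [hpa.2.2.1] at hu
        simp only [Option.mem_def, Option.some.injEq, List.head?_cons] at hu hv
        subst hu hv
        exact hax
      · obtain ⟨e, he, he0⟩ := hpa.2.1
        exact ⟨e, by rw [List.head?_append_of_ne_nil]; exact he; rintro h; simp [h] at he, he0⟩
      · intro z hz
        rcases List.mem_append.mp hz with hz | hz
        · exact (hpa.2.2.2 z hz).trans n.lt_succ_self
        · simp only [List.mem_singleton] at hz
          subst hz
          omega
      · intro y hy
        rw [List.disjoint_append_left, List.singleton_disjoint]
        refine ⟨hd a (Set.mem_insert _ _) y (Set.mem_insert_of_mem _ hy) ?_, ?_⟩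
        · rintro rfl
          exact haS hy
        · intro h
          exact absurd ((hp y (Set.mem_insert_of_mem _ hy)).2.2.2 x h) (by omega)

/-- Disjoint paths have distinct first edges. Boundedness matters because `sSup` of an unbounded set
of naturals is 0. -/
theorem bddAbove_disjoint_paths [Finite X] (A : Set V) (t : V) :
    BddAbove {k : ℕ | ∃ p : Fin k → List X,
      (∀ i, G.IsPath A t (p i)) ∧ ∀ i j, i ≠ j → List.Disjoint (p i) (p j)} := by
  refine ⟨Nat.card X, ?_⟩
  rintro k ⟨p, hp, hd⟩
  choose e he _ using fun i => (hp i).2.1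
  have hinj : Function.Injective e := by
    intro i j hij
    by_contra hne
    exact hd i j hne (List.mem_of_mem_head? (he i)) (hij ▸ List.mem_of_mem_head? (he j))
  simpa using Nat.card_le_card_of_injective e hinj

theorem exists_disjoint_paths_maxflow [Finite X] (A : Set V) (t : V) :
    ∃ p : Fin (G.maxflow A t) → List X,
      (∀ i, G.IsPath A t (p i)) ∧ ∀ i j, i ≠ j → List.Disjoint (p i) (p j) :=
  Nat.sSup_mem (s := {k : ℕ | ∃ p : Fin k → List X,
      (∀ i, G.IsPath A t (p i)) ∧ ∀ i j, i ≠ j → List.Disjoint (p i) (p j)})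
    ⟨0, fun i => i.elim0, fun i => i.elim0, fun i => i.elim0⟩ (bddAbove_disjoint_paths A t)

/-- The rank at `t` of a linear network code fed from `A` is at most the maximum flow. -/
theorem finrank_span_le_maxflow [Finite X] (hG : G.Acyclic) {K M : Type*} [Field K]
    [AddCommGroup M] [Module K M] (φ : X → M) (A : Set V) (t : V)
    (hφ : ∀ x, G.tail x ∉ A → φ x ∈ Submodule.span K (φ '' {a | G.Precedes a x})) :
    Module.finrank K (Submodule.span K (φ '' {a | G.head a = t})) ≤ G.maxflow A t := by
  obtain ⟨f, hinj, hf⟩ := hG.exists_numbering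
  have : FiniteDimensional K (Submodule.span K (φ '' {a | G.head a = t})) :=
    FiniteDimensional.span_of_finite K (Set.toFinite _)
  -- The basis is chosen among the edge vectors themselves, so that each member is carried by an
  -- edge into `t`.
  obtain ⟨v, hv, -, hind⟩ := Submodule.exists_fun_fin_finrank_span_eq K (φ '' {a | G.head a = t})
  choose a ha hav using hv
  have hφa : φ ∘ a = v := funext hav
  have hainj : Function.Injective a := by
    have := hind.injective
    rw [← hφa] at this
    exact this.of_comp
  obtain ⟨n, hn⟩ : ∃ n, ∀ x, f x < n := by
    obtain ⟨n, hn⟩ := (Set.finite_range f).bddAbove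
    exact ⟨n + 1, fun x => Nat.lt_succ_of_le (hn ⟨x, rfl⟩)⟩
  obtain ⟨p, hp, hd⟩ := exists_disjoint_paths_of_linearIndepOn f hinj hf φ {x | G.tail x ∈ A} hφ n
    (Set.range a) (fun x _ => hn x) ((linearIndepOn_range_iff hainj φ).mpr (hφa ▸ hind))
  refine le_csSup (bddAbove_disjoint_paths A t) ⟨fun i => p (a i), fun i => ?_, fun i j hij => ?_⟩
  · have := hp (a i) ⟨i, rfl⟩
    exact ⟨this.1, this.2.1, a i, this.2.2.1, ha i⟩
  · exact hd _ ⟨i, rfl⟩ _ ⟨j, rfl⟩ (hainj.ne hij)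

end MultiDigraph

end RLNC

/-! ### Schwartz–Zippel and coordinate projections -/

namespace RLNC

open scoped Classical in
/-- The Schwartz–Zippel lemma for an arbitrary finite set of variables over a finite field. -/
theorem card_zeros_div_le {σ F : Type*} [Fintype σ] [Field F] [Fintype F]
    {p : MvPolynomial σ F} (hp : p ≠ 0) :
    ((Finset.univ.filter fun c : σ → F => MvPolynomial.eval c p = 0).card : ℝ) /
      Fintype.card (σ → F) ≤ p.totalDegree / Fintype.card F := by
  let e := Fintype.equivFin σ
  have hq : MvPolynomial.rename e p ≠ 0 := fun h =>
    hp (MvPolynomial.rename_injective e e.injective (by simpa using h))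
  have hsz := MvPolynomial.schwartz_zippel_totalDegree hq (Finset.univ : Finset F)
  have hdeg : (MvPolynomial.rename e p).totalDegree ≤ p.totalDegree :=
    MvPolynomial.totalDegree_rename_le e p
  have hcard : (Finset.univ.filter fun c : σ → F => MvPolynomial.eval c p = 0).card =
      (Finset.filter (fun c => MvPolynomial.eval c (MvPolynomial.rename e p) = 0)
        (Fintype.piFinset fun _ : Fin (Fintype.card σ) => (Finset.univ : Finset F))).card := by
    refine Finset.card_bij (fun c _ => c ∘ e.symm) ?_ ?_ ?_
    · intro c hc
      simp only [Finset.mem_filter, Finset.mem_univ, true_and] at hc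
      simpa [MvPolynomial.eval_rename, Function.comp_assoc] using hc
    · intro c _ d _ h
      funext x
      simpa using congrFun h (e x)
    · intro c hc
      refine ⟨c ∘ e, ?_, ?_⟩
      · simpa [MvPolynomial.eval_rename] using hc
      · funext x
        simp
  rw [hcard]
  have hsz' : (((Finset.filter (fun c => MvPolynomial.eval c (MvPolynomial.rename e p) = 0)
      (Fintype.piFinset fun _ : Fin (Fintype.card σ) => (Finset.univ : Finset F))).card /
      ((Finset.univ : Finset F).card ^ Fintype.card σ : ℚ≥0) : ℚ≥0) : ℝ) ≤
      (((MvPolynomial.rename e p).totalDegree / (Finset.univ : Finset F).card : ℚ≥0) : ℝ) := by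
    exact_mod_cast hsz
  push_cast at hsz'
  simp only [Finset.card_univ] at hsz'
  rw [Fintype.card_fun]
  push_cast
  refine hsz'.trans ?_
  gcongr

/-- A subspace contains the standard basis vectors indexed by the finite set `D` iff restricting to
the other coordinates lowers its dimension by exactly `#D`. -/
theorem single_mem_iff_finrank {ι F : Type*} [Fintype ι] [DecidableEq ι] [Field F]
    (W : Submodule F (ι → F)) (D : Finset ι) (q : ι → Prop)
    (hq : ∀ i, q i ↔ i ∉ D) :
    (∀ i ∈ D, (Pi.single i 1 : ι → F) ∈ W) ↔
      Module.finrank F (W.map (LinearMap.funLeft F F (Subtype.val : {i // q i} → ι))) + D.card =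
        Module.finrank F W := by
  classical
  -- `ker π` is spanned by the basis vectors in `D`. Rank–nullity on `W` makes the drop in dimension
  -- that of `W ⊓ ker π`, which is `#D` iff `ker π ≤ W`.
  set π := LinearMap.funLeft F F (Subtype.val : {i // q i} → ι) with hπ
  have hsurj : Function.Surjective π :=
    LinearMap.funLeft_surjective_of_injective F F _ Subtype.val_injective
  have hker : Module.finrank F (LinearMap.ker π) = D.card := by
    have h1 := LinearMap.finrank_range_add_finrank_ker π
    have h2 : Fintype.card {i // q i} = Fintype.card {i // i ∉ D} :=
      Fintype.card_congr (Equiv.subtypeEquivRight hq)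
    rw [LinearMap.range_eq_top.mpr hsurj, finrank_top, Module.finrank_fintype_fun_eq_card, h2,
      Module.finrank_fintype_fun_eq_card, Fintype.card_subtype_compl, Fintype.card_coe] at h1
    have := D.card_le_univ
    omega
  have hdim : Module.finrank F (W.map π) + Module.finrank F (W ⊓ LinearMap.ker π : Submodule F _) =
      Module.finrank F W := by
    have h1 := LinearMap.finrank_range_add_finrank_ker (π.domRestrict W)
    rw [LinearMap.range_domRestrict] at h1
    rw [← h1, LinearMap.ker_domRestrict]
    congr 1
    have h2 := (Submodule.equivSubtypeMap W ((LinearMap.ker π).comap W.subtype)).finrank_eq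
    rw [Submodule.map_comap_subtype] at h2
    exact h2.symm
  have hmem : (∀ i ∈ D, (Pi.single i 1 : ι → F) ∈ W) ↔ LinearMap.ker π ≤ W := by
    constructor
    · intro h v hv
      rw [pi_eq_sum_univ' v]
      refine Submodule.sum_mem _ fun i _ => ?_
      by_cases hi : i ∈ D
      · refine Submodule.smul_mem _ _ ?_
        convert h i hi using 1
      · have : v i = 0 := congrFun (LinearMap.mem_ker.mp hv) ⟨i, (hq i).mpr hi⟩
        simp [this]
    · intro h i hi
      refine h (LinearMap.mem_ker.mpr ?_)
      funext j
      simp only [hπ, LinearMap.funLeft_apply, Pi.zero_apply]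
      exact Pi.single_eq_of_ne (by rintro h; exact (hq _).mp j.2 (h ▸ hi)) _
  rw [hmem, ← hdim, ← hker, Nat.add_left_cancel_iff, ← inf_eq_right]
  constructor
  · intro h
    rw [h]
  · intro h
    exact Submodule.eq_of_le_of_finrank_eq inf_le_right h.symm

/-! ### Ranks, polynomials and routing for network codes -/

namespace Network

variable {V E : Type*} {m : ℕ} (N : Network V E m) (r : Fin m → ℕ)

variable [Fintype E] {F : Type*} [Field F]

/-- Forgetting all coordinates outside the sources in `B`. -/
def restrict (F : Type*) [Field F] (B : Set (Fin m)) :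
    ((Σ i : Fin m, Fin (r i)) → F) →ₗ[F] ({ij : Σ i : Fin m, Fin (r i) // ij.1 ∈ B} → F) :=
  LinearMap.funLeft F F Subtype.val

/-- The space received at `t`. -/
def received (c : N.CoeffIndex r → F) (t : V) :
    Submodule F ((Σ i : Fin m, Fin (r i)) → F) :=
  Submodule.span F (N.code r c '' {a | (N.extend r).head a = Sum.inl t})

/-- The dimension of what `t` receives from the sources in `B` when the others are silent. -/
noncomputable def rankFrom (B : Set (Fin m)) (c : N.CoeffIndex r → F) (t : V) : ℕ :=
  Module.finrank F ((N.received r c t).map (restrict r F B))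

/-- After projection, auxiliary edges from sources outside `B` carry 0, which lies in every span;
only edges starting in `B` are exempt from the combination rule. -/
theorem rankFrom_le_maxflow (B : Set (Fin m)) (c : N.CoeffIndex r → F) (t : V) :
    N.rankFrom r B c t ≤ (N.extend r).maxflow (Sum.inr '' B) (Sum.inl t) := by
  rw [rankFrom, received, Submodule.map_span, ← Set.image_comp]
  refine (N.extend r).finrank_span_le_maxflow (N.extend_acyclic r) _ _ _ ?_
  rintro (e | ij) hx
  · rw [Function.comp_apply, code_inl, map_sum]
    refine Submodule.sum_mem _ fun a _ => ?_
    rw [map_smul]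
    exact Submodule.smul_mem _ _ (Submodule.subset_span ⟨a.1, a.2, rfl⟩)
  · convert Submodule.zero_mem _
    rw [Function.comp_apply, code_inr]
    funext kl
    simp only [restrict, LinearMap.funLeft_apply, Pi.zero_apply]
    refine Pi.single_eq_of_ne ?_ _
    intro h
    exact hx ⟨ij.1, h ▸ kl.2, rfl⟩

open scoped Classical in
theorem decodes_iff_rankFrom (c : N.CoeffIndex r → F) (t : V) :
    N.Decodes r c t ↔
      N.rankFrom r {i | i ∉ N.dem t} c t + ∑ i ∈ N.dem t, r i = N.rankFrom r Set.univ c t := by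
  have hspan : Submodule.span F {v | ∃ a, (N.extend r).head a = Sum.inl t ∧ v = N.code r c a} =
      N.received r c t := by
    rw [received]
    congr 1
    ext v
    simp only [Set.mem_ofPred_eq, Set.mem_image]
    exact exists_congr fun a => and_congr_right fun _ => eq_comm
  have huniv : N.rankFrom r Set.univ c t = Module.finrank F (N.received r c t) := by
    rw [rankFrom]
    exact (Submodule.equivMapOfInjective _ (LinearMap.funLeft_injective_of_surjective F F _
      fun x => ⟨⟨x, trivial⟩, rfl⟩) _).finrank_eq.symm
  -- The predicate is phrased as membership so that the projection unfolds to `restrict`.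
  have hD := single_mem_iff_finrank (N.received r c t)
    ((N.dem t).sigma fun i => (Finset.univ : Finset (Fin (r i))))
    (fun ij => ij.1 ∈ {i | i ∉ N.dem t}) (by simp)
  rw [huniv, Decodes, hspan]
  have hcard : ((N.dem t).sigma fun i => (Finset.univ : Finset (Fin (r i)))).card =
      ∑ i ∈ N.dem t, r i := by simp
  rw [hcard] at hD
  refine Iff.trans ?_ hD
  constructor
  · rintro h ⟨i, j⟩ hij
    convert h i (by simpa using hij) j
  · intro h i hi j
    convert h ⟨i, j⟩ (by simpa using hi)

/-- Each coordinate of the code is a polynomial in the coefficients, of degree bounded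
independently of the field. -/
theorem exists_code_polynomial (f : E ⊕ (Σ i : Fin m, Fin (r i)) → ℕ)
    (hf : ∀ a b, (N.extend r).Precedes a b → f a < f b)
    (x : E ⊕ (Σ i : Fin m, Fin (r i))) (ij : Σ i : Fin m, Fin (r i)) :
    ∃ P : MvPolynomial (N.CoeffIndex r) F,
      P.totalDegree ≤ f x ∧ ∀ c, MvPolynomial.eval c P = N.code r c x ij := by
  classical
  induction x using (N.extend_acyclic r).wellFounded.induction with
  | _ x ih =>
  rcases x with e | kl
  · choose! P hdeg hev using ih
    let idx : {a // (N.extend r).Precedes a (Sum.inl e)} → N.CoeffIndex r :=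
      fun a => ⟨(a.1, e), a.2⟩
    refine ⟨∑ a : {a // (N.extend r).Precedes a (Sum.inl e)},
      MvPolynomial.X (idx a) * P a.1, ?_, ?_⟩
    -- Passing to a successor edge costs one variable, hence one degree, while `f` grows by at least
    -- one.
    · refine (MvPolynomial.totalDegree_finsetSum _ _).trans (Finset.sup_le fun a _ => ?_)
      refine (MvPolynomial.totalDegree_mul _ _).trans ?_
      rw [MvPolynomial.totalDegree_X]
      have h1 := hdeg a.1 a.2
      have h2 := hf _ _ a.2
      omega
    · intro c
      rw [code_inl, map_sum, Finset.sum_apply]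
      refine Finset.sum_congr rfl fun a _ => ?_
      rw [map_mul, MvPolynomial.eval_X, hev a.1 a.2, Pi.smul_apply, smul_eq_mul]
  · refine ⟨MvPolynomial.C ((Pi.single kl 1 : (Σ i : Fin m, Fin (r i)) → F) ij), by simp, fun c => ?_⟩
    rw [code_inr, MvPolynomial.eval_C]

open scoped Classical in
/-- Routing along edge-disjoint paths: with suitable coefficients the last edge of every path
carries the symbol injected at its first edge. -/
theorem exists_routing {k : ℕ} {B : Set (Fin m)} {t : V}
    (p : Fin k → List (E ⊕ (Σ i : Fin m, Fin (r i))))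
    (hp : ∀ i, (N.extend r).IsPath (Sum.inr '' B) (Sum.inl t) (p i))
    (hd : ∀ i j, i ≠ j → List.Disjoint (p i) (p j)) :
    ∃ (s : Fin k → Σ i : Fin m, Fin (r i)) (a : Fin k → E ⊕ (Σ i : Fin m, Fin (r i))),
      Function.Injective s ∧ (∀ i, (s i).1 ∈ B) ∧
      (∀ i, (N.extend r).head (a i) = Sum.inl t) ∧
      ∀ (F : Type) [Field F], ∃ c : N.CoeffIndex r → F,
        ∀ i, N.code r c (a i) = Pi.single (s i) 1 := by
  obtain ⟨f, -, hf⟩ := (N.extend_acyclic r).exists_numbering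
  have hs : ∀ i, ∃ s : Σ i : Fin m, Fin (r i), s.1 ∈ B ∧ (p i)[0]? = some (Sum.inr s) := by
    intro i
    obtain ⟨e | s, he, b, hb, hbe⟩ := (hp i).2.1
    · simp [extend] at hbe
    · refine ⟨s, ?_, by simpa [List.head?_eq_getElem?] using he⟩
      simp only [extend, Sum.elim_inr, Sum.inr.injEq] at hbe
      exact hbe ▸ hb
  choose s hsB hs using hs
  choose a ha hat using fun i => (hp i).2.2
  have huniq : ∀ i j x, x ∈ p i → x ∈ p j → i = j := by
    intro i j x hi hj
    by_contra hne
    exact hd i j hne hi hj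
  have hnodup : ∀ i, (p i).Nodup := by
    intro i
    have : IsTrans _ (fun a b => f a < f b) := ⟨fun _ _ _ => lt_trans⟩
    have h1 : (p i).IsChain fun a b => f a < f b := (hp i).1.imp hf
    exact (List.isChain_iff_pairwise.mp h1).imp fun h => by rintro rfl; exact h.false
  refine ⟨s, a, ?_, hsB, hat, fun F _ => ?_⟩
  · intro i j hij
    have h1 := hs i
    rw [hij] at h1
    exact huniq i j _ (List.mem_of_getElem? h1) (List.mem_of_getElem? (hs j))
  -- Coefficient 1 exactly for consecutive edges on one of the paths.
  let c : N.CoeffIndex r → F := fun q =>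
    if ∃ i n, (p i)[n]? = some q.1.1 ∧ (p i)[n + 1]? = some (Sum.inl q.1.2) then 1 else 0
  have hcode : ∀ (i : Fin k) (n : ℕ) (x : E ⊕ (Σ i : Fin m, Fin (r i))), (p i)[n]? = some x → N.code r c x = Pi.single (s i) 1 := by
    intro i n
    induction n with
    | zero =>
      intro x hx
      rw [hs i, Option.some.injEq] at hx
      rw [← hx, code_inr]
    | succ n ih =>
      intro x hx
      obtain ⟨hn1, hx'⟩ := List.getElem?_eq_some_iff.mp hx
      have hn : n < (p i).length := by omega
      have hprec : (N.extend r).Precedes (p i)[n] x := by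
        have := List.isChain_iff_getElem.mp (hp i).1 n hn1
        rwa [hx'] at this
      rcases x with e | kl
      swap
      · simp only [MultiDigraph.Precedes, extend, Sum.elim_inr] at hprec
        rcases h : (p i)[n] with e' | e' <;> simp [h] at hprec
      rw [code_inl, Finset.sum_eq_single ⟨(p i)[n], hprec⟩]
      · have hc : c ⟨((p i)[n], e), hprec⟩ = 1 :=
          if_pos ⟨i, n, List.getElem?_eq_getElem hn, hx⟩
        rw [hc, one_smul]
        exact ih _ (List.getElem?_eq_getElem hn)
      -- The edge `e` lies on only one path and occurs there once, so no other incoming edge has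
      -- coefficient 1.
      · rintro ⟨b, hb⟩ - hne
        have hc : c ⟨(b, e), hb⟩ = 0 := by
          refine if_neg ?_
          rintro ⟨j, l, h1, h2⟩
          have hij : i = j :=
            huniq i j _ (List.mem_of_getElem? hx) (List.mem_of_getElem? h2)
          subst hij
          have hl : l = n := by
            have := (List.getElem?_inj hn1 (hnodup i)).mp (hx.trans h2.symm)
            omega
          subst hl
          rw [List.getElem?_eq_getElem hn, Option.some.injEq] at h1
          exact hne (Subtype.ext h1.symm)
        rw [hc, zero_smul]
      · intro h
        exact absurd (Finset.mem_univ _) h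
  refine ⟨c, fun i => ?_⟩
  have h1 := ha i
  rw [Option.mem_def, List.getLast?_eq_getElem?] at h1
  exact hcode i _ _ h1

end Network

end RLNC

/-! ### Generic ranks and probability bounds -/

namespace RLNC

namespace Network

variable {V E : Type*} {m : ℕ} (N : Network V E m) (r : Fin m → ℕ) [Fintype E]

open scoped Classical in
/-- The probability, over uniform coefficients in `F`, of the event `P`. -/
noncomputable def coeffProb (F : Type) [Field F] [Fintype F] (P : (N.CoeffIndex r → F) → Prop) :
    ℝ :=
  letI : Fintype (N.CoeffIndex r) := Fintype.ofFinite _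
  ((Finset.univ.filter P).card : ℝ) / Fintype.card (N.CoeffIndex r → F)

section

variable {N r} {F : Type} [Field F] [Fintype F]

theorem coeffProb_mono {P Q : (N.CoeffIndex r → F) → Prop} (h : ∀ c, P c → Q c) :
    N.coeffProb r F P ≤ N.coeffProb r F Q := by
  classical
  unfold coeffProb
  gcongr with c
  exact h c

theorem coeffProb_nonneg (P : (N.CoeffIndex r → F) → Prop) : 0 ≤ N.coeffProb r F P := by
  unfold coeffProb
  positivity

theorem coeffProb_add_not (P : (N.CoeffIndex r → F) → Prop) :
    N.coeffProb r F P + N.coeffProb r F (fun c => ¬ P c) = 1 := by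
  classical
  unfold coeffProb
  let : Fintype (N.CoeffIndex r) := Fintype.ofFinite _
  have h0 : (Fintype.card (N.CoeffIndex r → F) : ℝ) ≠ 0 := by
    exact_mod_cast Fintype.card_ne_zero
  rw [← add_div, div_eq_one_iff_eq h0, ← Finset.card_univ]
  rw [← Nat.cast_add, Nat.cast_inj]
  convert Finset.card_filter_add_card_filter_not P

theorem coeffProb_exists_le {ι : Type*} (s : Finset ι) (P : ι → (N.CoeffIndex r → F) → Prop) :
    N.coeffProb r F (fun c => ∃ i ∈ s, P i c) ≤ ∑ i ∈ s, N.coeffProb r F (P i) := by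
  classical
  unfold coeffProb
  rw [← Finset.sum_div]
  gcongr
  rw [← Nat.cast_sum]
  refine Nat.cast_le.mpr ((Finset.card_le_card ?_).trans Finset.card_biUnion_le)
  intro c hc
  simpa using hc

theorem coeffProb_or_le (P Q : (N.CoeffIndex r → F) → Prop) :
    N.coeffProb r F (fun c => P c ∨ Q c) ≤ N.coeffProb r F P + N.coeffProb r F Q := by
  have := coeffProb_exists_le (N := N) (r := r) (Finset.univ : Finset Bool)
    (fun b => if b then P else Q)
  simpa [or_comm] using this

theorem successProb_eq_coeffProb :
    N.successProb r F = N.coeffProb r F (fun c => N.Succeeds r c) := by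
  classical
  let : Fintype (N.CoeffIndex r) := Fintype.ofFinite _
  let : Fintype {c : N.CoeffIndex r → F | N.Succeeds r c} := Fintype.ofFinite _
  unfold successProb coeffProb
  rw [PMF.toOuterMeasure_uniformOfFintype_apply, ENNReal.toReal_div, ENNReal.toReal_natCast,
    ENNReal.toReal_natCast, Fintype.card_subtype]
  congr!

end

/-- With probability `1 - O(1/|F|)`, the rank received from `B` is the maximum flow. -/
theorem exists_coeffProb_rankFrom_ne_le (B : Set (Fin m)) (t : V) :
    ∃ C : ℝ, ∀ (F : Type) [Field F] [Fintype F],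
      N.coeffProb r F (fun c => N.rankFrom r B c t ≠
        (N.extend r).maxflow (Sum.inr '' B) (Sum.inl t)) ≤ C / Fintype.card F := by
  classical
  obtain ⟨f, -, hf⟩ := (N.extend_acyclic r).exists_numbering
  obtain ⟨p, hp, hd⟩ :=
    (N.extend r).exists_disjoint_paths_maxflow (Sum.inr '' B) (Sum.inl t)
  obtain ⟨s, a, hinj, hsB, hat, hroute⟩ := N.exists_routing r p hp hd
  -- The edges `a i` and symbols `s i` were fixed before the field, so this constant does not depend
  -- on `F`.
  refine ⟨∑ i, f (a i), fun F _ _ => ?_⟩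
  let : Fintype (N.CoeffIndex r) := Fintype.ofFinite _
  choose P hPdeg hPev using fun i j => N.exists_code_polynomial r (F := F) f hf (a i) (s j)
  -- The minor with rows the last edges of the paths and columns the symbols they route; at the
  -- routing coefficients it is the determinant of the identity.
  let Q : MvPolynomial (N.CoeffIndex r) F := (Matrix.of P).det
  have hQev : ∀ c, MvPolynomial.eval c Q =
      (Matrix.of fun i j => N.code r c (a i) (s j)).det := by
    intro c
    rw [RingHom.map_det]
    congr 1
    ext i j
    simp [hPev]
  have hQ : Q ≠ 0 := by
    obtain ⟨c, hc⟩ := hroute F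
    intro h
    have h1 := hQev c
    rw [h, map_zero] at h1
    have h2 : (Matrix.of fun i j => N.code r c (a i) (s j)) = 1 := by
      ext i j
      rw [Matrix.of_apply, hc, Matrix.one_apply, Pi.single_apply]
      exact if_congr (hinj.eq_iff.trans eq_comm) rfl rfl
    rw [h2, Matrix.det_one] at h1
    exact zero_ne_one h1
  have hQdeg : Q.totalDegree ≤ ∑ i, f (a i) := by
    change (Matrix.det (Matrix.of P)).totalDegree ≤ _
    rw [Matrix.det_apply]
    refine (MvPolynomial.totalDegree_finsetSum _ _).trans (Finset.sup_le fun σ _ => ?_)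
    have h1 : (∏ i, Matrix.of P (σ i) i).totalDegree ≤ ∑ i, f (a i) := by
      refine (MvPolynomial.totalDegree_finsetProd _ _).trans ?_
      rw [← Equiv.sum_comp σ fun i => f (a i)]
      exact Finset.sum_le_sum fun i _ => hPdeg _ _
    rcases Int.units_eq_one_or (Equiv.Perm.sign σ) with h | h
    · rwa [h, one_smul]
    · rwa [h, Units.neg_smul, one_smul, MvPolynomial.totalDegree_neg]
  have hgood : ∀ c, MvPolynomial.eval c Q ≠ 0 →
      N.rankFrom r B c t = (N.extend r).maxflow (Sum.inr '' B) (Sum.inl t) := by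
    intro c hc
    refine le_antisymm (N.rankFrom_le_maxflow r B c t) ?_
    rw [hQev] at hc
    have hrows := Matrix.linearIndependent_rows_of_det_ne_zero hc
    -- All columns `s j` belong to sources in `B`, so the minor factors through `restrict` and
    -- independence lifts.
    have hind : LinearIndependent F fun i => restrict r F B (N.code r c (a i)) :=
      LinearIndependent.of_comp (LinearMap.funLeft F F fun j => ⟨s j, hsB j⟩) hrows
    have hle : Submodule.span F (Set.range fun i => restrict r F B (N.code r c (a i))) ≤
        (N.received r c t).map (restrict r F B) := by
      rw [Submodule.span_le]
      rintro _ ⟨i, rfl⟩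
      exact Submodule.mem_map_of_mem (Submodule.subset_span ⟨a i, hat i, rfl⟩)
    have h1 := Submodule.finrank_mono hle
    rwa [finrank_span_eq_card hind, Fintype.card_fin] at h1
  calc _ ≤ N.coeffProb r F (fun c => MvPolynomial.eval c Q = 0) :=
        coeffProb_mono fun c hc => by
          by_contra h
          exact hc (hgood c h)
    _ ≤ Q.totalDegree / Fintype.card F := card_zeros_div_le hQ
    _ ≤ _ := by
        gcongr
        exact_mod_cast hQdeg

/-- The flow condition at the sink `t`. -/
def FlowCondition (t : V) : Prop :=
  (N.extend r).maxflow (superSources \ ⋃ i ∈ N.dem t, {Sum.inr i}) (Sum.inl t)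
    + ∑ i ∈ N.dem t, r i = (N.extend r).maxflow superSources (Sum.inl t)

/-- With probability `1 - O(1/|F|)`, the sink `t` decodes iff the flow condition holds at `t`. -/
theorem exists_coeffProb_decodes_iff_le (t : V) :
    ∃ C : ℝ, ∀ (F : Type) [Field F] [Fintype F],
      N.coeffProb r F (fun c => ¬ (N.Decodes r c t ↔ N.FlowCondition r t)) ≤
        C / Fintype.card F := by
  obtain ⟨C₁, h₁⟩ := N.exists_coeffProb_rankFrom_ne_le r {i | i ∉ N.dem t} t
  obtain ⟨C₂, h₂⟩ := N.exists_coeffProb_rankFrom_ne_le r Set.univ t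
  refine ⟨C₁ + C₂, fun F _ _ => ?_⟩
  rw [add_div]
  refine ((coeffProb_mono fun c hc => ?_).trans (coeffProb_or_le _ _)).trans
    (add_le_add (h₁ F) (h₂ F))
  by_contra! h
  refine hc ?_
  have hcompl : (superSources \ ⋃ i ∈ N.dem t, {Sum.inr i} : Set (V ⊕ Fin m)) =
      Sum.inr '' {i | i ∉ N.dem t} := by
    ext (v | i) <;> simp [superSources]
  rw [FlowCondition, hcompl, superSources, ← Set.image_univ, ← h.1, ← h.2]
  exact N.decodes_iff_rankFrom r c t

end Network

/-! ### Limits over large fields -/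

/-- A quantity that is `O(1/|F|)` is eventually small. -/
theorem exists_div_card_lt (C : ℝ) {ε : ℝ} (hε : 0 < ε) :
    ∃ n : ℕ, ∀ (F : Type) [Field F] [Fintype F], n ≤ Fintype.card F →
      C / Fintype.card F < ε := by
  obtain ⟨n, hn⟩ := exists_nat_gt (C / ε)
  refine ⟨n, fun F _ _ hF => ?_⟩
  have h0 : (0 : ℝ) < Fintype.card F := by exact_mod_cast Fintype.card_pos
  have h1 : C / ε < Fintype.card F := hn.trans_le (by exact_mod_cast hF)
  rw [div_lt_iff₀ h0]
  rw [div_lt_iff₀ hε] at h1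
  linarith

/-- Arbitrarily large finite fields exist, namely `ZMod q` with `q` prime, so the limit is not
vacuous. -/
theorem TendstoLargeField.unique {P : ∀ (F : Type) [Field F] [Fintype F], ℝ} {l l' : ℝ}
    (h : TendstoLargeField P l) (h' : TendstoLargeField P l') : l = l' := by
  by_contra hne
  have hpos : 0 < |l - l'| / 2 := half_pos (abs_pos.mpr (sub_ne_zero.mpr hne))
  obtain ⟨n, hn⟩ := h _ hpos
  obtain ⟨n', hn'⟩ := h' _ hpos
  obtain ⟨q, hq, hprime⟩ := Nat.exists_infinite_primes (max n n')
  have : Fact q.Prime := ⟨hprime⟩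
  have h1 := hn (ZMod q) (by rw [ZMod.card]; exact (le_max_left _ _).trans hq)
  have h2 := hn' (ZMod q) (by rw [ZMod.card]; exact (le_max_right _ _).trans hq)
  have h3 := abs_sub_le l (P (ZMod q)) l'
  rw [abs_sub_comm l (P (ZMod q))] at h3
  linarith

end RLNC

theorem theorem1 {V E : Type*} [Fintype V] [Fintype E] {m : ℕ}
    (N : RLNC.Network V E m) (r : Fin m → ℕ) :
    (RLNC.TendstoLargeField (fun F _ _ => N.successProb r F) 1 ↔
      ∀ t ∈ N.sinks,
        (N.extend r).maxflow
            (RLNC.Network.superSources \ ⋃ i ∈ N.dem t, {Sum.inr i}) (Sum.inl t)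
          + ∑ i ∈ N.dem t, r i
          = (N.extend r).maxflow RLNC.Network.superSources (Sum.inl t)) ∧
    ((¬ ∀ t ∈ N.sinks,
        (N.extend r).maxflow
            (RLNC.Network.superSources \ ⋃ i ∈ N.dem t, {Sum.inr i}) (Sum.inl t)
          + ∑ i ∈ N.dem t, r i
          = (N.extend r).maxflow RLNC.Network.superSources (Sum.inl t)) →
      RLNC.TendstoLargeField (fun F _ _ => N.successProb r F) 0) := by
  have hpos : (∀ t ∈ N.sinks, N.FlowCondition r t) →
      RLNC.TendstoLargeField (fun F _ _ => N.successProb r F) 1 := by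
    intro hcond ε hε
    choose C hC using N.exists_coeffProb_decodes_iff_le r
    obtain ⟨n, hn⟩ := RLNC.exists_div_card_lt (∑ t ∈ N.sinks, C t) hε
    refine ⟨n, fun F _ _ hF => ?_⟩
    have hadd := RLNC.Network.coeffProb_add_not (F := F) fun c => N.Succeeds r c
    have hfail : N.coeffProb r F (fun c => ¬ N.Succeeds r c) < ε := by
      refine lt_of_le_of_lt ?_ (hn F hF)
      rw [Finset.sum_div]
      refine ((RLNC.Network.coeffProb_mono fun c hc => ?_).trans
        (RLNC.Network.coeffProb_exists_le N.sinks fun t c =>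
          ¬ (N.Decodes r c t ↔ N.FlowCondition r t))).trans
        (Finset.sum_le_sum fun t _ => hC t F)
      -- When every flow condition holds, overall failure forces some sink to violate its
      -- equivalence.
      by_contra! h
      exact hc fun t ht => (h t ht).mpr (hcond t ht)
    have h0 := RLNC.Network.coeffProb_nonneg (F := F) fun c => ¬ N.Succeeds r c
    change |N.successProb r F - 1| < ε
    rw [RLNC.Network.successProb_eq_coeffProb, abs_lt]
    constructor <;> linarith
  have hneg : (¬ ∀ t ∈ N.sinks, N.FlowCondition r t) →
      RLNC.TendstoLargeField (fun F _ _ => N.successProb r F) 0 := by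
    intro hcond ε hε
    push Not at hcond
    obtain ⟨t, ht, hnot⟩ := hcond
    obtain ⟨C, hC⟩ := N.exists_coeffProb_decodes_iff_le r t
    obtain ⟨n, hn⟩ := RLNC.exists_div_card_lt C hε
    refine ⟨n, fun F _ _ hF => ?_⟩
    change |N.successProb r F - 0| < ε
    rw [RLNC.Network.successProb_eq_coeffProb, sub_zero,
      abs_of_nonneg (RLNC.Network.coeffProb_nonneg _)]
    refine ((RLNC.Network.coeffProb_mono fun c hc => ?_).trans (hC F)).trans_lt (hn F hF)
    exact fun h => hnot (h.mp (hc t ht))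
  refine ⟨⟨fun h1 => ?_, hpos⟩, hneg⟩
  by_contra hcond
  exact one_ne_zero (h1.unique (hneg hcond))
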